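/- **Theorem 2.1.** Let $k\ge 1$ and let $\lambda=(\lambda_1\ge\lambda_2\ge\dots\ge\lambda_k\ge 0)$ be a partition with at most $k$ parts; put $n=k+\lambda_1$. The Schur polynomial is the flag minor $$s_\lambda(x_1,\dots,x_k)=\det\bigl(X_{ij}\bigr)_{i\in I(\lambda),\,1\le j\le k},\qquad X_{ij}=\frac{x_j^{\,i-1}}{\prod_{a<j}(x_j-x_a)},\qquad I(\lambda)=\{\lambda_k+1,\lambda_{k-1}+2,\dots,\lambda_1+k\}\subseteq\{1,\dots,n\},$$ with entries in the field $\mathbb Q(x_1,\dots,x_k)$. A subtraction-free arithmetic circuit is a sequence of gates, each performing one addition, multiplication or division on operands taken from the variables, the positive integers and the results of earlier gates; its size is the number of gates, no gate may divide by zero, and its output is the result of the last gate. Then $s_\lambda(x_1,\dots,x_k)$ can be computed by a subtraction-free arithmetic circuit of size $O(n^3)$, and the corresponding algorithm has bit complexity $O(n^3\log^2 n)$. Precisely: there are a single random access program $P$ and a constant $C$ such that, for all such $k$ and $\lambda$, the program $P$ on input $(k;\lambda_1,\dots,\lambda_k)$ halts, having issued one after the other the gates of a subtraction-free arithmetic circuit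 that computes $s_\lambda(x_1,\dots,x_k)$ and has at most $C\,n^3$ gates, at a total bit cost of at most $C\,n^3\,(1+\lfloor\log_2 n\rfloor)^2$. Here bit cost is logarithmic cost: each integer operation, memory access, test, or operand reference is charged the binary lengths of the integers and addresses involved (a multiplication of integers is charged the product of the lengths of its factors), and issuing a gate, i.e. performing one arithmetic operation on the values of the $x_j$, is charged one unit plus the cost of addressing its two operands. -/

import Mathlib

noncomputable section

namespace SchurCircuit

/-! ### Arithmetic circuits -/

inductive ArithOp
  | add | sub | mul | div

/-- An operand of a gate: an input variable, an input scalar, or the result of an earlier gate.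
All numbering starts at `0`. -/
inductive Operand (α : Type) : Type
  | var (i : α)
  | scalar (c : α)
  | gate (j : α)

structure Gate (α : Type) : Type where
  op : ArithOp
  left : Operand α
  right : Operand α

/-- An arithmetic circuit, its gates listed in an order in which they can be evaluated.
Its size is the number of gates, i.e. the length of the list. -/
abbrev Circuit : Type := List (Gate ℕ)

/-- The result of an arithmetic operation; division by zero has no result. -/
def ArithOp.apply {K : Type} [Field K] (op : ArithOp) (a b : K) : Option K :=
  open Classical in
  match op with
  | .add => some (a + b)
  | .sub => some (a - b)
  | .mul => some (a * b)
  | .div => if b = 0 then none else some (a / b)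

/-- The value of an operand, given the values `x` of the `k` input variables and the list of the
results of the preceding gates. Only positive integers are admitted as scalars, and references to
missing variables or gates have no value. -/
def Operand.value {K : Type} [Field K] {k : ℕ} (x : Fin k → K) (results : List K) :
    Operand ℕ → Option K
  | .var i => if h : i < k then some (x ⟨i, h⟩) else none
  | .scalar c => if 0 < c then some (c : K) else none
  | .gate j => results[j]?

def Gate.value {K : Type} [Field K] {k : ℕ} (x : Fin k → K) (results : List K) (g : Gate ℕ) :
    Option K :=
  (g.left.value x results).bind fun a =>
    (g.right.value x results).bind fun b => g.op.apply a b

/-- Evaluates the gates one after the other, appending each result to the list of results. -/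
def Circuit.run {K : Type} [Field K] {k : ℕ} (x : Fin k → K) :
    Circuit → List K → Option (List K)
  | [], results => some results
  | g :: c, results => (g.value x results).bind fun v => Circuit.run x c (results ++ [v])

/-- On inputs `x`, every gate of `c` can be evaluated, and the last gate outputs `f`. -/
def Circuit.Computes {K : Type} [Field K] {k : ℕ} (c : Circuit) (x : Fin k → K) (f : K) : Prop :=
  ∃ results : List K, c.run x [] = some results ∧ results.getLast? = some f

def Circuit.SubtractionFree (c : Circuit) : Prop :=
  ∀ g ∈ c, g.op ≠ ArithOp.sub

/-! ### Schur polynomials -/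

/-- The field `ℚ(x₁, …, x_k)` of rational functions. -/
abbrev RatFun (k : ℕ) : Type := FractionRing (MvPolynomial (Fin k) ℚ)

def x (k : ℕ) (j : Fin k) : RatFun k :=
  algebraMap (MvPolynomial (Fin k) ℚ) (RatFun k) (MvPolynomial.X j)

/-- The first `k` columns of the rescaled Vandermonde matrix
`X_{ij} = x_j ^ (i - 1) / ∏_{a < j} (x_j - x_a)`; they involve `x₁, …, x_k` only. Rows and columns
are numbered from `0`, and there is no bound on the number of rows, of which
only the first `k + λ₁` matter for a partition `λ`. -/
def rescaledVandermonde (k : ℕ) : Matrix ℕ (Fin k) (RatFun k) :=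
  Matrix.of fun i j => x k j ^ i / ∏ a ∈ Finset.Iio j, (x k j - x k a)

/-- The rows `λ_k + 1 < λ_{k-1} + 2 < ⋯ < λ₁ + k` in increasing order (here numbered from `0`,
hence smaller by one). -/
def rowIndex {k : ℕ} (lam : Fin k → ℕ) (i : Fin k) : ℕ :=
  lam (Fin.rev i) + i

/-- The Schur polynomial `s_λ(x₁, …, x_k)`: the flag minor of the rescaled Vandermonde matrix on
the rows `rowIndex lam` and the first `k` columns. -/
def schur {k : ℕ} (lam : Fin k → ℕ) : RatFun k :=
  ((rescaledVandermonde k).submatrix (rowIndex lam) id).det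

/-! ### Random access programs with logarithmic cost

The memory has cells numbered by `ℕ`, each holding a natural number. Every operation is charged
the binary lengths of all the numbers and addresses it handles, and a multiplication the product
of the lengths of its factors. -/

/-- The number of binary digits of `m`. -/
def bitLength (m : ℕ) : ℕ := Nat.log 2 m + 1

abbrev Memory : Type := ℕ → ℕ

/-- Integer expressions; `read a` is the content of the memory cell with address `a`, and
`sub` is truncated subtraction. -/
inductive Exp : Type
  | lit (c : ℕ)
  | read (a : Exp)
  | add (a b : Exp)
  | sub (a b : Exp)
  | mul (a b : Exp)

def Exp.eval (m : Memory) : Exp → ℕ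
  | .lit c => c
  | .read a => m (a.eval m)
  | .add a b => a.eval m + b.eval m
  | .sub a b => a.eval m - b.eval m
  | .mul a b => a.eval m * b.eval m

/-- The bit cost of evaluating an expression. -/
def Exp.cost (m : Memory) : Exp → ℕ
  | .lit c => bitLength c
  | .read a => a.cost m + bitLength (a.eval m) + bitLength (m (a.eval m))
  | .add a b => a.cost m + b.cost m + bitLength (a.eval m) + bitLength (b.eval m)
  | .sub a b => a.cost m + b.cost m + bitLength (a.eval m) + bitLength (b.eval m)
  | .mul a b => a.cost m + b.cost m + bitLength (a.eval m) * bitLength (b.eval m)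

def Operand.map {α β : Type} (f : α → β) : Operand α → Operand β
  | .var i => .var (f i)
  | .scalar c => .scalar (f c)
  | .gate j => .gate (f j)

def Gate.map {α β : Type} (f : α → β) (g : Gate α) : Gate β :=
  ⟨g.op, g.left.map f, g.right.map f⟩

/-- The number (of a variable or gate), or the scalar, that occurs in an operand. -/
def Operand.index {α : Type} : Operand α → α
  | .var i => i
  | .scalar c => c
  | .gate j => j

/-- The bit cost of addressing an operand that is given by an expression. -/
def Operand.cost (m : Memory) (o : Operand Exp) : ℕ :=
  o.index.cost m + bitLength (o.index.eval m)

/-- Programs. `store a e` puts the value of `e` into the cell with address `a`; `emit g` outputs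
an arithmetic gate, the operands of which are given by expressions; conditions are true when
nonzero. -/
inductive Prog : Type
  | skip
  | store (a e : Exp)
  | emit (g : Gate Exp)
  | seq (p q : Prog)
  | ite (e : Exp) (p q : Prog)
  | while (e : Exp) (p : Prog)

/-- `Runs p m c m' t`: started with memory `m`, the program `p` halts with memory `m'` after
having output the list of gates `c`, at a total bit cost of `t`. -/
inductive Runs : Prog → Memory → Circuit → Memory → ℕ → Prop
  | skip (m : Memory) : Runs .skip m [] m 1
  | store (m : Memory) (a e : Exp) :
      Runs (.store a e) m [] (Function.update m (a.eval m) (e.eval m))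
        (a.cost m + e.cost m + bitLength (a.eval m) + bitLength (e.eval m))
  | emit (m : Memory) (g : Gate Exp) :
      Runs (.emit g) m [g.map (Exp.eval m)] m (1 + g.left.cost m + g.right.cost m)
  | seq {p q : Prog} {m₁ m₂ m₃ : Memory} {c₁ c₂ : Circuit} {t₁ t₂ : ℕ} :
      Runs p m₁ c₁ m₂ t₁ → Runs q m₂ c₂ m₃ t₂ → Runs (.seq p q) m₁ (c₁ ++ c₂) m₃ (t₁ + t₂)
  | ite_true {e : Exp} {p q : Prog} {m m' : Memory} {c : Circuit} {t : ℕ} :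
      e.eval m ≠ 0 → Runs p m c m' t →
        Runs (.ite e p q) m c m' (e.cost m + bitLength (e.eval m) + t)
  | ite_false {e : Exp} {p q : Prog} {m m' : Memory} {c : Circuit} {t : ℕ} :
      e.eval m = 0 → Runs q m c m' t →
        Runs (.ite e p q) m c m' (e.cost m + bitLength (e.eval m) + t)
  | while_true {e : Exp} {p : Prog} {m₁ m₂ m₃ : Memory} {c₁ c₂ : Circuit} {t₁ t₂ : ℕ} :
      e.eval m₁ ≠ 0 → Runs p m₁ c₁ m₂ t₁ → Runs (.while e p) m₂ c₂ m₃ t₂ →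
        Runs (.while e p) m₁ (c₁ ++ c₂) m₃ (e.cost m₁ + bitLength (e.eval m₁) + t₁ + t₂)
  | while_false {e : Exp} {p : Prog} {m : Memory} :
      e.eval m = 0 → Runs (.while e p) m [] m (e.cost m + bitLength (e.eval m))

/-- The initial memory: `k` in cell `0`, then `λ₁, …, λ_k` in cells `1, …, k`, and `0` in every
other cell. -/
def inputMemory {k : ℕ} (lam : Fin k → ℕ) : Memory
  | 0 => k
  | i + 1 => if h : i < k then lam ⟨i, h⟩ else 0

end SchurCircuit

end

namespace SchurCircuit

/-! ### Flag minors -/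

section FlagMinor

variable {R : Type*} [CommRing R]

/-! Cut every part of λ down to at most s, and let F(s, m, u) be the minor of the rescaled
Vandermonde matrix on m + 1 successive selected rows, from the u-th on, and the first m + 1 columns
(`truncMinor`). Passing from s to s + 1 fixes the rows whose part is at most s and raises the others
by one. The latter are consecutive, so the change amounts to deleting the lowest of them from the
increasing list of rows.

If no row moves, F is unchanged. If all move, the rows are consecutive before and after, and F is
multiplied by the product of the first m + 1 variables (`truncMinor_succ_of_lt`, from
`flagMinor_vandermonde`). Otherwise a three-term Plücker relation (`flagMinor_skip_mul`) expresses
F(s + 1, m + 1, u) · F(s, m, u + 1) as a sum of two products of entries that precede (s + 1, m + 1,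
u) lexicographically (`truncMinor_succ_mul`). This relation has only plus signs, so the whole table
is filled in without subtraction. Its entries are positive at (1, …, 1), as quotients of polynomials
with positive values there (`PosAtOne`), so no divisor vanishes.

All rows are raised by one from the start. This makes the product of the first m + 1 variables
itself a table entry, F(0, m, 0), and one final division removes the extra factor
(`truncMinor_div`).

The table has (λ₁ + 1)k² ≤ n³ entries, with four gates for each, so gate numbers are explicit in (s,
m, u). The program therefore stores only three counters beside its input. Its loop body is free of
loops and handles numbers of O(log n) bits, hence costs O(log² n) per entry
(`Prog.LoopFree.exists_bound`). -/

/-- The minor of `X` on the rows `w 0, …, w (n - 1)` and the first `n` columns. -/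
def flagMinor (X : ℕ → ℕ → R) (n : ℕ) (w : ℕ → ℕ) : R :=
  Matrix.det (Matrix.of fun i j : Fin n => X (w i) j)

/-- The increasing enumeration of the natural numbers other than `p`. -/
def skip (p i : ℕ) : ℕ := if i < p then i else i + 1

lemma val_succAbove_eq_skip {n : ℕ} (p : Fin (n + 1)) (i : Fin n) :
    (p.succAbove i : ℕ) = skip p i := by
  unfold skip Fin.succAbove
  simp only [Fin.lt_def, Fin.val_castSucc]
  split_ifs <;> simp

lemma flagMinor_congr {X : ℕ → ℕ → R} {n : ℕ} {w w' : ℕ → ℕ} (h : ∀ i < n, w i = w' i) :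
    flagMinor X n w = flagMinor X n w' := by
  unfold flagMinor
  congr 1
  ext i j
  simp [h i i.2]

/-- A determinant vanishes when its first column is a linear combination of the other ones. -/
lemma det_eq_zero_of_column_zero_eq_sum {n : ℕ} (A : Matrix (Fin (n + 1)) (Fin (n + 1)) R)
    (c : Fin n → R) (h : ∀ i, A i 0 = ∑ j, c j * A i j.succ) : A.det = 0 := by
  have key : A = A.updateCol 0 (∑ j : Fin n, c j • A.col j.succ) := by
    ext i j
    refine Fin.cases ?_ (fun j => ?_) j
    · simp [h, Matrix.col]
    · rw [Matrix.updateCol_ne (Fin.succ_ne_zero j)]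
  have : ∀ s : Finset (Fin n), (A.updateCol 0 (∑ j ∈ s, c j • A.col j.succ)).det = 0 := by
    intro s
    induction s using Finset.induction_on with
    | empty =>
      exact Matrix.det_eq_zero_of_column_eq_zero 0 (fun i => by simp)
    | insert a s ha ih =>
      rw [Finset.sum_insert ha, Matrix.det_updateCol_add, ih, Matrix.det_updateCol_smul,
        Matrix.det_zero_of_column_eq (i := 0) (j := a.succ) (Fin.succ_ne_zero a).symm]
      · simp
      · intro i
        simp [Matrix.col]
  rw [key]
  exact this _

/-- Laplace expansion along the replaced row: the coefficients do not involve `v`, so the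
determinant is a fixed linear form in `v`. -/
lemma det_updateRow_eq_sum {n : ℕ} (N : Matrix (Fin n) (Fin n) R) (p : Fin n) (v : Fin n → R) :
    (N.updateRow p v).det = ∑ j, N.adjugate j p * v j := by
  rw [← Matrix.cramer_transpose_apply, Matrix.cramer_eq_adjugate_mulVec]
  simp [Matrix.mulVec, dotProduct, ← Matrix.adjugate_transpose N]

/-- The three-term relation between the flag minors of a matrix, when a row is deleted. -/
lemma flagMinor_skip_mul (X : ℕ → ℕ → R) (w : ℕ → ℕ) (m p : ℕ) (hp : p < m) :
    flagMinor X (m + 1) (w ∘ skip (p + 1)) * flagMinor X m (fun i => w (i + 1)) =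
      flagMinor X (m + 1) w * flagMinor X m (fun i => w (skip (p + 1) (i + 1))) +
        flagMinor X (m + 1) (fun i => w (i + 1)) * flagMinor X m (w ∘ skip (p + 1)) := by
  obtain ⟨m, rfl⟩ : ∃ n, m = n + 1 := ⟨m - 1, by omega⟩
  set N : Matrix (Fin (m + 1)) (Fin (m + 1)) R := Matrix.of fun i j => X (w (i + 1)) j with hN
  set q : Fin (m + 1) := ⟨p, hp⟩ with hq
  -- Being one fixed linear form applied to every row, the column `ell` is a combination of the
  -- other columns of `A`, so `det A = 0`. In the expansion along it only the rows 0, p + 1 and m +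
  -- 2 survive, since at the others `ell` is a determinant with a repeated row.
  let ell : ℕ → R := fun i => (N.updateRow q fun j => X (w i) j).det
  let A : Matrix (Fin (m + 3)) (Fin (m + 3)) R :=
    Matrix.of fun i => Fin.cons (ell i) fun j : Fin (m + 2) => X (w i) j
  have hA : A.det = 0 := by
    refine det_eq_zero_of_column_zero_eq_sum A
      (Fin.snoc (α := fun _ => R) (fun j : Fin (m + 1) => N.adjugate j q) 0) fun i => ?_
    simp only [A, ell, Matrix.of_apply, Fin.cons_zero, Fin.cons_succ, det_updateRow_eq_sum]
    refine Eq.symm ((Fin.sum_univ_castSucc _).trans ?_)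
    simp
  have hsub : ∀ i : Fin (m + 3), (A.submatrix i.succAbove Fin.succ).det =
      flagMinor X (m + 2) (w ∘ skip i) := by
    intro i
    unfold flagMinor
    congr 1
    ext a b
    simp [A, val_succAbove_eq_skip]
  have ell_mid : ∀ i : ℕ, i < m + 1 → i ≠ p → ell (i + 1) = 0 := by
    intro i hi hip
    refine Matrix.det_zero_of_row_eq (i := q) (j := ⟨i, hi⟩) ?_ ?_
    · intro h
      exact hip (by simpa [hq, Fin.ext_iff] using h.symm)
    · rw [Matrix.updateRow_self, Matrix.updateRow_ne]
      · rfl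
      · simpa [hq, Fin.ext_iff] using hip
  have ell_p : ell (p + 1) = flagMinor X (m + 1) (fun i => w (i + 1)) := by
    have : (fun j : Fin (m + 1) => X (w (p + 1)) j) = N q := rfl
    simp only [ell, this, Matrix.updateRow_eq_self]
    rfl
  -- Row `w 0` sits in position p; moving it to the front restores the order of the rows at the cost
  -- of p transpositions.
  have ell_zero : ell 0 = (-1) ^ p * flagMinor X (m + 1) (w ∘ skip (p + 1)) := by
    have h := Matrix.det_permute q.cycleRange
      (Matrix.of fun i j : Fin (m + 1) => X ((w ∘ skip (p + 1)) i) j)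
    rw [Fin.sign_cycleRange] at h
    have e : ((Matrix.of fun i j : Fin (m + 1) => X ((w ∘ skip (p + 1)) i) j).submatrix
        q.cycleRange id) = N.updateRow q fun j => X (w 0) j := by
      ext i j
      rcases lt_trichotomy i q with hi | hi | hi
      · have hi' : (i : ℕ) < p := hi
        rw [Matrix.updateRow_ne hi.ne]
        simp [Fin.coe_cycleRange_of_lt hi, skip, hi', hN]
      · subst hi
        simp [skip]
      · have hi' : p < (i : ℕ) := hi
        rw [Matrix.updateRow_ne hi.ne']
        have : ¬ ((i : ℕ) ≤ p) := by omega
        simp [Fin.cycleRange_of_gt hi, skip, this, hN]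
    rw [e] at h
    simpa [hq, flagMinor] using h
  -- Here the new row travels from position p to the end, past m - p others.
  have ell_last : ell (m + 2) =
      (-1) ^ (m - p) * flagMinor X (m + 1) (fun i => w (skip (p + 1) (i + 1))) := by
    have hle : q ≤ Fin.last m := Fin.le_last q
    have h := Matrix.det_permute (Fin.cycleIcc q (Fin.last m))
      (N.updateRow q fun j => X (w (m + 2)) j)
    rw [Fin.sign_cycleIcc_of_le hle] at h
    have e : (N.updateRow q fun j => X (w (m + 2)) j).submatrix
        (Fin.cycleIcc q (Fin.last m)) id =
          Matrix.of fun i j : Fin (m + 1) => X (w (skip (p + 1) (i + 1))) j := by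
      ext i j
      rcases lt_or_ge i q with hi | hi
      · have hi' : (i : ℕ) < p := hi
        rw [Matrix.submatrix_apply, Fin.cycleIcc_of_lt hi, Matrix.updateRow_ne hi.ne]
        simp [skip, hi', hN]
      · have hi' : ¬ (i : ℕ) < p := not_lt.mpr hi
        rw [Matrix.submatrix_apply, Fin.cycleIcc_of_le_of_le hi (Fin.le_last i)]
        split_ifs with hl
        · subst hl
          have : ¬ m < p := by simpa using hi'
          simp [skip, this]
        · have hlt : (i : ℕ) < m := by
            have := Fin.val_lt_last hl
            simpa using this
          have hv : ((i + 1 : Fin (m + 1)) : ℕ) = i + 1 :=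
            Fin.val_add_one_of_lt (Fin.lt_last_iff_ne_last.mpr hl)
          rw [Matrix.updateRow_ne]
          · simp [skip, hi', hN, hv]
          · intro h
            rw [Fin.ext_iff, hv] at h
            simp [hq] at h
            omega
    rw [e] at h
    have hsq : ((-1 : R) ^ (m - p)) * (-1) ^ (m - p) = 1 := by
      rw [← mul_pow]
      simp
    have h' : flagMinor X (m + 1) (fun i => w (skip (p + 1) (i + 1))) =
        (-1) ^ (m - p) * ell (m + 2) := by
      simpa [hq, flagMinor, ell] using h
    rw [h', ← mul_assoc, hsq, one_mul]
  have hskip_zero : w ∘ skip 0 = fun i => w (i + 1) := by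
    ext i
    simp [skip]
  have hskip_last : flagMinor X (m + 2) (w ∘ skip (m + 2)) = flagMinor X (m + 2) w :=
    flagMinor_congr fun i hi => by simp [skip, hi]
  rw [Matrix.det_succ_column_zero, Fin.sum_univ_succ, Fin.sum_univ_castSucc,
    Finset.sum_eq_single q] at hA
  · simp only [hsub] at hA
    simp only [A, Matrix.of_apply, Fin.cons_zero, Fin.val_zero, pow_zero, one_mul, Fin.val_succ,
      Fin.val_castSucc, Fin.val_last, ell_zero, hskip_zero, hskip_last] at hA
    have hqv : (q : ℕ) = p := rfl
    rw [hqv, ell_p, ell_last] at hA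
    -- The sign of the last cofactor splits so as to cancel that of `ell_last`. Up to squares of
    -- signs, the outer terms then carry (-1)^p and the middle one its negative.
    have hpow : (-1 : R) ^ (m + 1 + 1) = (-1) ^ p * (-1) ^ (m - p) := by
      rw [← pow_add, pow_add _ (m + 1) 1, pow_succ]
      have : p + (m - p) = m := by omega
      rw [this]
      ring
    have hsq : ((-1 : R) ^ p) * (-1) ^ p = 1 := by
      rw [← mul_pow]
      simp
    have hsq' : ((-1 : R) ^ (m - p)) * (-1) ^ (m - p) = 1 := by
      rw [← mul_pow]
      simp
    rw [hpow, pow_succ] at hA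
    linear_combination (-(-1 : R) ^ p) * hA +
      (flagMinor X (m + 2) (fun i => w (i + 1)) * flagMinor X (m + 1) (w ∘ skip (p + 1)) -
       flagMinor X (m + 2) (w ∘ skip (p + 1)) * flagMinor X (m + 1) (fun i => w (i + 1)) +
       flagMinor X (m + 2) w * flagMinor X (m + 1) (fun i => w (skip (p + 1) (i + 1)))) * hsq +
       ((-1 : R) ^ p * (-1) ^ p * flagMinor X (m + 2) w *
         flagMinor X (m + 1) (fun i => w (skip (p + 1) (i + 1)))) * hsq'
  · intro i _ hi
    have h : ell (i + 1) = 0 := ell_mid i i.2 (by simpa [hq, Fin.ext_iff] using hi)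
    simp [A, h]
  · simp

end FlagMinor

/-- The minor of the rescaled Vandermonde matrix on consecutive rows. -/
lemma flagMinor_vandermonde {K : Type*} [Field K] (y : ℕ → K) (n : ℕ)
    (hy : ∀ a < n, ∀ b < n, y a = y b → a = b) (s : ℕ) :
    flagMinor (fun i j => y j ^ i / ∏ a ∈ Finset.range j, (y j - y a)) n (fun i => i + s) =
      (∏ a ∈ Finset.range n, y a) ^ s := by
  have hV : (∏ j ∈ Finset.range n, ∏ a ∈ Finset.range j, (y j - y a)) ≠ 0 := by
    refine Finset.prod_ne_zero_iff.mpr fun j hj => Finset.prod_ne_zero_iff.mpr fun a ha => ?_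
    rw [Finset.mem_range] at hj ha
    rw [sub_ne_zero]
    intro h
    have := hy j hj a (ha.trans hj) h
    omega
  -- Each column is a scalar multiple of a Vandermonde column, and the denominators multiply to
  -- exactly the Vandermonde determinant.
  have hM : (Matrix.of fun i j : Fin n =>
      y j ^ ((i : ℕ) + s) / ∏ a ∈ Finset.range j, (y j - y a)) =
      Matrix.of fun i j : Fin n => (y j ^ s / ∏ a ∈ Finset.range j, (y j - y a)) *
        (Matrix.vandermonde fun j : Fin n => y j).transpose i j := by
    ext i j
    simp only [Matrix.of_apply, Matrix.transpose_apply, Matrix.vandermonde_apply]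
    rw [pow_add]
    ring
  have hdet : (Matrix.vandermonde fun j : Fin n => y j).det =
      ∏ j ∈ Finset.range n, ∏ a ∈ Finset.range j, (y j - y a) := by
    rw [Matrix.det_vandermonde, Finset.prod_sigma', Finset.prod_sigma']
    refine Finset.prod_bij' (fun p _ => ⟨(p.2 : ℕ), (p.1 : ℕ)⟩)
      (fun p hp => ⟨⟨p.2, ?_⟩, ⟨p.1, ?_⟩⟩) ?_ ?_ ?_ ?_ ?_
    · simp at hp; omega
    · simp at hp; omega
    · rintro ⟨i, j⟩ h
      simpa using h
    · rintro ⟨i, j⟩ h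
      simpa [Fin.lt_def] using (show j < i by simp at h; omega)
    · rintro ⟨i, j⟩ h
      rfl
    · rintro ⟨i, j⟩ h
      rfl
    · rintro ⟨i, j⟩ h
      rfl
  unfold flagMinor
  rw [hM, Matrix.det_mul_row, Matrix.det_transpose, hdet, Finset.prod_div_distrib,
    Fin.prod_univ_eq_prod_range (fun j => y j ^ s),
    Fin.prod_univ_eq_prod_range (fun j => ∏ a ∈ Finset.range j, (y j - y a)),
    div_mul_cancel₀ _ hV, Finset.prod_pow]

/-! ### Minors for truncated partitions -/

section Truncation

variable {k : ℕ} (lam : Fin k → ℕ)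

/-- The parts of `lam` in increasing order, continued by repeating the largest one; written the
way a program looks them up in the input memory. -/
def ascPart (v : ℕ) : ℕ := inputMemory lam (1 + (k - (v + 1)))

/-- The `v`-th row (in increasing order, from `0` on) selected by `lam` truncated at `s`, shifted
by one. -/
def truncRow (s v : ℕ) : ℕ := v + min s (ascPart lam v) + 1

/-- The variables, indexed by `ℕ`. -/
noncomputable def natVar (k j : ℕ) : RatFun k := if h : j < k then x k ⟨j, h⟩ else 0

/-- The flag minor of the rescaled Vandermonde matrix on the `m + 1` rows starting with the `u`-th
one selected by the truncation of `lam` at `s`. -/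
noncomputable def truncMinor (s m u : ℕ) : RatFun k :=
  flagMinor (fun i j => natVar k j ^ i / ∏ a ∈ Finset.range j, (natVar k j - natVar k a)) (m + 1)
    (fun i => truncRow lam s (u + i))

variable {lam}

lemma ascPart_of_lt {v : ℕ} (hv : v < k) : ascPart lam v = lam (Fin.rev ⟨v, hv⟩) := by
  have h : 1 + (k - (v + 1)) = (k - (v + 1)) + 1 := Nat.add_comm _ _
  have h' : k - (v + 1) < k := by omega
  rw [ascPart, h]
  simp only [inputMemory, h', dite_true]
  rfl

/-- Truncated subtraction sends all these lookups to cell 1, which holds the largest part. Windows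
running past the last row thus still make sense. -/
lemma ascPart_of_le (hk : 0 < k) {v : ℕ} (hv : k ≤ v + 1) : ascPart lam v = lam ⟨0, hk⟩ := by
  have h : 1 + (k - (v + 1)) = 0 + 1 := by omega
  rw [ascPart, h]
  simp [inputMemory, hk]

lemma ascPart_le (hl : Antitone lam) (hk : 0 < k) (v : ℕ) : ascPart lam v ≤ lam ⟨0, hk⟩ := by
  by_cases hv : v < k
  · rw [ascPart_of_lt hv]
    exact hl (Fin.le_def.mpr (Nat.zero_le _))
  · rw [ascPart_of_le hk (by omega)]

lemma ascPart_mono (hl : Antitone lam) : Monotone (ascPart lam) := by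
  intro v w h
  by_cases hw : w < k
  · rw [ascPart_of_lt hw, ascPart_of_lt (h.trans_lt hw)]
    exact hl (Fin.rev_le_rev.mpr h)
  · rcases Nat.eq_zero_or_pos k with rfl | hk
    · simp [ascPart]
    · rw [ascPart_of_le hk (v := w) (by omega)]
      exact ascPart_le hl hk v

lemma natVar_injOn : ∀ a < k, ∀ b < k, natVar k a = natVar k b → a = b := by
  intro a ha b hb h
  simp only [natVar, ha, hb, dite_true, x] at h
  have := MvPolynomial.X_injective (IsFractionRing.injective (MvPolynomial (Fin k) ℚ) _ h)
  simpa using this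

lemma truncMinor_of_le_ascPart (hl : Antitone lam) {s m u : ℕ} (hm : m < k)
    (hs : s ≤ ascPart lam u) :
    truncMinor lam s m u = (∏ a ∈ Finset.range (m + 1), natVar k a) ^ (u + s + 1) := by
  rw [truncMinor, ← flagMinor_vandermonde _ _ (fun a ha b hb =>
    natVar_injOn a (by omega) b (by omega))]
  refine flagMinor_congr fun i _ => ?_
  have := ascPart_mono hl (Nat.le_add_right u i)
  rw [truncRow, min_eq_left (hs.trans this)]
  omega

lemma truncMinor_zero (hl : Antitone lam) {m : ℕ} (hm : m < k) (u : ℕ) :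
    truncMinor lam 0 m u = (∏ a ∈ Finset.range (m + 1), natVar k a) ^ (u + 1) := by
  rw [truncMinor_of_le_ascPart hl hm (Nat.zero_le _), add_zero]

/-- By monotonicity every row of the window moves, so both windows consist of consecutive rows and
the minors are powers of one monomial. -/
lemma truncMinor_succ_of_lt (hl : Antitone lam) {s m u : ℕ} (hm : m < k) (hs : s < ascPart lam u) :
    truncMinor lam (s + 1) m u = truncMinor lam s m u * truncMinor lam 0 m 0 := by
  rw [truncMinor_zero hl hm, truncMinor_of_le_ascPart (s := s + 1) hl hm hs,
    truncMinor_of_le_ascPart hl hm hs.le]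
  ring

lemma truncMinor_succ_of_le (hl : Antitone lam) {s m u : ℕ} (hs : ascPart lam (u + m) ≤ s) :
    truncMinor lam (s + 1) m u = truncMinor lam s m u := by
  refine flagMinor_congr fun i hi => ?_
  have : ascPart lam (u + i) ≤ ascPart lam (u + m) := ascPart_mono hl (by omega)
  simp only [truncRow]
  omega

/-- The hypotheses say that the first row of the window stays and the last one moves, which is the
case covered by the three-term relation. -/
lemma truncMinor_succ_mul (hl : Antitone lam) {s m u : ℕ} (hu : ascPart lam u ≤ s)
    (hs : s < ascPart lam (u + (m + 1))) :
    truncMinor lam (s + 1) (m + 1) u * truncMinor lam s m (u + 1) =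
      truncMinor lam s (m + 1) u * truncMinor lam (s + 1) m (u + 1) +
        truncMinor lam s (m + 1) (u + 1) * truncMinor lam (s + 1) m u := by
  classical
  have hex : ∃ p, s < ascPart lam (u + p) := ⟨m + 1, hs⟩
  -- The first row that moves is number p + 1; it cannot be number 0 because of `hu`.
  obtain ⟨p, hp⟩ : ∃ p, Nat.find hex = p + 1 := by
    refine Nat.exists_eq_succ_of_ne_zero fun h => ?_
    have := Nat.find_spec hex
    rw [h, add_zero] at this
    omega
  have hpm : p < m + 1 := by
    have := Nat.find_min' hex hs
    omega
  -- From row p + 1 on the rows are consecutive, so raising each by one replaces it by its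
  -- successor.
  have hrow : ∀ i, truncRow lam (s + 1) (u + i) = truncRow lam s (u + skip (p + 1) i) := by
    intro i
    unfold skip truncRow
    split_ifs with h
    · have := Nat.find_min hex (m := i) (by omega)
      omega
    · have h1 : ascPart lam (u + (p + 1)) ≤ ascPart lam (u + i) := ascPart_mono hl (by omega)
      have h2 : ascPart lam (u + i) ≤ ascPart lam (u + (i + 1)) := ascPart_mono hl (by omega)
      have h3 := Nat.find_spec hex
      rw [hp] at h3
      omega
  have key := flagMinor_skip_mul
    (fun i j => natVar k j ^ i / ∏ a ∈ Finset.range j, (natVar k j - natVar k a))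
    (fun i => truncRow lam s (u + i)) (m + 1) p hpm
  have e : ∀ n t : ℕ, truncMinor lam t n (u + 1) = flagMinor
      (fun i j => natVar k j ^ i / ∏ a ∈ Finset.range j, (natVar k j - natVar k a)) (n + 1)
      (fun i => truncRow lam t (u + (i + 1))) := by
    intro n t
    unfold truncMinor
    congr 1
    ext i
    rw [add_assoc, add_comm 1 i]
  rw [e, e, e]
  unfold truncMinor
  simp only [hrow]
  exact key

lemma natVar_ne_zero {j : ℕ} (hj : j < k) : natVar k j ≠ 0 := by
  simp only [natVar, hj, dite_true, x]
  intro h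
  rw [map_eq_zero_iff _ (IsFractionRing.injective (MvPolynomial (Fin k) ℚ) _)] at h
  exact MvPolynomial.X_ne_zero _ h

/-- Raising all exponents by one multiplies column j by the j-th variable; the divisor is the
product of these factors. -/
lemma truncMinor_div (hl : Antitone lam) (hk : 0 < k) :
    truncMinor lam (lam ⟨0, hk⟩) (k - 1) 0 / truncMinor lam 0 (k - 1) 0 = schur lam := by
  obtain ⟨n, rfl⟩ : ∃ n, k = n + 1 := ⟨k - 1, by omega⟩
  have hne : (∏ a ∈ Finset.range (n + 1), natVar (n + 1) a) ≠ 0 :=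
    Finset.prod_ne_zero_iff.mpr fun a ha => natVar_ne_zero (Finset.mem_range.mp ha)
  rw [Nat.add_sub_cancel, truncMinor_zero hl (Nat.lt_succ_self n), zero_add, pow_one,
    div_eq_iff hne, truncMinor, flagMinor, schur, mul_comm,
    ← Fin.prod_univ_eq_prod_range (natVar (n + 1)) (n + 1), ← Matrix.det_mul_row]
  congr 1
  ext i j
  have hrow : truncRow lam (lam ⟨0, hk⟩) (0 + i) = rowIndex lam i + 1 := by
    rw [zero_add, truncRow, min_eq_right (ascPart_le hl hk i), ascPart_of_lt i.2, rowIndex]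
    exact congrArg (· + 1) (Nat.add_comm _ _)
  have hprod : ∏ a ∈ Finset.range (j : ℕ), (x (n + 1) j - natVar (n + 1) a) =
      ∏ a ∈ Finset.Iio j, (x (n + 1) j - x (n + 1) a) := by
    symm
    refine Finset.prod_bij (fun a _ => (a : ℕ)) ?_ ?_ ?_ ?_
    · intro a ha
      simpa using ha
    · intro a _ b _ h
      exact Fin.ext h
    · intro b hb
      have hb' : b < (j : ℕ) := Finset.mem_range.mp hb
      exact ⟨⟨b, hb'.trans j.2⟩, by simpa [Fin.lt_def] using hb', rfl⟩
    · intro a _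
      simp only [natVar, a.2, dite_true]
  have hx : natVar (n + 1) j = x (n + 1) j := by
    simp only [natVar, j.2, dite_true]
  simp only [Matrix.of_apply, Matrix.submatrix_apply, rescaledVandermonde, hrow, hx, id, hprod]
  ring

end Truncation

/-! ### Positivity -/

/-- Quotients of polynomials that are positive at `(1, …, 1)`. -/
def PosAtOne {k : ℕ} (f : RatFun k) : Prop :=
  ∃ p q : MvPolynomial (Fin k) ℚ, 0 < MvPolynomial.eval 1 p ∧ 0 < MvPolynomial.eval 1 q ∧
    f = algebraMap _ (RatFun k) p / algebraMap _ (RatFun k) q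

namespace PosAtOne

variable {k : ℕ} {f g : RatFun k}

lemma algebraMap_ne_zero {p : MvPolynomial (Fin k) ℚ} (hp : 0 < MvPolynomial.eval 1 p) :
    algebraMap _ (RatFun k) p ≠ 0 := by
  rw [Ne, map_eq_zero_iff _ (IsFractionRing.injective (MvPolynomial (Fin k) ℚ) _)]
  rintro rfl
  simp at hp

lemma ne_zero (hf : PosAtOne f) : f ≠ 0 := by
  obtain ⟨p, q, hp, hq, rfl⟩ := hf
  exact div_ne_zero (algebraMap_ne_zero hp) (algebraMap_ne_zero hq)

lemma one : PosAtOne (1 : RatFun k) := ⟨1, 1, by simp, by simp, by simp⟩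

lemma natVar {j : ℕ} (hj : j < k) : PosAtOne (natVar k j) :=
  ⟨MvPolynomial.X ⟨j, hj⟩, 1, by simp, by simp, by simp [SchurCircuit.natVar, hj, x]⟩

lemma add (hf : PosAtOne f) (hg : PosAtOne g) : PosAtOne (f + g) := by
  obtain ⟨p, q, hp, hq, rfl⟩ := hf
  obtain ⟨r, t, hr, ht, rfl⟩ := hg
  refine ⟨p * t + q * r, q * t, ?_, ?_, ?_⟩
  · simp only [map_add, map_mul]; positivity
  · simp only [map_mul]; positivity
  · rw [div_add_div _ _ (algebraMap_ne_zero hq) (algebraMap_ne_zero ht)]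
    simp only [map_add, map_mul]

lemma mul (hf : PosAtOne f) (hg : PosAtOne g) : PosAtOne (f * g) := by
  obtain ⟨p, q, hp, hq, rfl⟩ := hf
  obtain ⟨r, t, hr, ht, rfl⟩ := hg
  refine ⟨p * r, q * t, ?_, ?_, ?_⟩
  · simp only [map_mul]; positivity
  · simp only [map_mul]; positivity
  · rw [div_mul_div_comm]
    simp only [map_mul]

lemma div (hf : PosAtOne f) (hg : PosAtOne g) : PosAtOne (f / g) := by
  obtain ⟨p, q, hp, hq, rfl⟩ := hf
  obtain ⟨r, t, hr, ht, rfl⟩ := hg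
  refine ⟨p * t, q * r, ?_, ?_, ?_⟩
  · simp only [map_mul]; positivity
  · simp only [map_mul]; positivity
  · rw [div_div_div_eq]
    simp only [map_mul]

end PosAtOne

/-! ### Binary lengths -/

lemma one_le_bitLength (a : ℕ) : 1 ≤ bitLength a := Nat.le_add_left _ _

lemma bitLength_mono {a b : ℕ} (h : a ≤ b) : bitLength a ≤ bitLength b :=
  Nat.succ_le_succ (Nat.log_mono_right h)

lemma bitLength_le_of_lt_two_pow {a b : ℕ} (hb : 1 ≤ b) (h : a < 2 ^ b) : bitLength a ≤ b := by
  rcases Nat.eq_zero_or_pos a with rfl | ha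
  · simpa [bitLength] using hb
  · exact Nat.log_lt_of_lt_pow ha.ne' h

lemma lt_two_pow_bitLength (a : ℕ) : a < 2 ^ bitLength a :=
  Nat.lt_pow_succ_log_self one_lt_two a

lemma bitLength_mul_le (a b : ℕ) : bitLength (a * b) ≤ bitLength a + bitLength b := by
  refine bitLength_le_of_lt_two_pow ((one_le_bitLength a).trans (Nat.le_add_right _ _)) ?_
  rw [pow_add]
  exact Nat.mul_lt_mul'' (lt_two_pow_bitLength a) (lt_two_pow_bitLength b)

lemma bitLength_add_le (a b : ℕ) : bitLength (a + b) ≤ bitLength a + bitLength b := by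
  refine bitLength_le_of_lt_two_pow ((one_le_bitLength a).trans (Nat.le_add_right _ _)) ?_
  have ha := lt_two_pow_bitLength a
  have hb := lt_two_pow_bitLength b
  rw [pow_add]
  have h1 : 2 ≤ 2 ^ bitLength a := Nat.le_self_pow (one_le_bitLength a |>.trans_lt' one_pos).ne' 2
  have h2 : 2 ≤ 2 ^ bitLength b := Nat.le_self_pow (one_le_bitLength b |>.trans_lt' one_pos).ne' 2
  nlinarith

/-! ### Loop-free programs -/

/-- `L` plays the role of log n, and the constant depends only on the expression and on `A`. The
cost is quadratic in `L` because a product is charged the product of the lengths. -/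
lemma Exp.exists_bound (e : Exp) (A : ℕ) : ∃ B, ∀ (L : ℕ) (m : Memory), 1 ≤ L →
    (∀ a, bitLength (m a) ≤ A * L) →
      bitLength (e.eval m) ≤ B * L ∧ e.cost m ≤ B * L ^ 2 := by
  have hsq : ∀ L : ℕ, 1 ≤ L → L ≤ L ^ 2 := fun L hL => Nat.le_self_pow two_ne_zero L
  induction e with
  | lit c =>
    refine ⟨bitLength c, fun L m hL _ => ⟨?_, ?_⟩⟩
    · exact Nat.le_mul_of_pos_right _ hL
    · exact Nat.le_mul_of_pos_right _ (pow_pos hL 2)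
  | read a ih =>
    obtain ⟨B, hB⟩ := ih
    refine ⟨2 * B + A, fun L m hL hm => ?_⟩
    obtain ⟨h1, h2⟩ := hB L m hL hm
    have h3 := hm (a.eval m)
    have h4 := hsq L hL
    refine ⟨?_, ?_⟩
    · exact h3.trans (Nat.mul_le_mul_right _ (Nat.le_add_left _ _))
    · simp only [Exp.cost]
      nlinarith
  | add a b iha ihb =>
    obtain ⟨B, hB⟩ := iha
    obtain ⟨D, hD⟩ := ihb
    refine ⟨2 * (B + D), fun L m hL hm => ?_⟩
    obtain ⟨h1, h2⟩ := hB L m hL hm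
    obtain ⟨h3, h4⟩ := hD L m hL hm
    have h5 := hsq L hL
    refine ⟨?_, ?_⟩
    · have := bitLength_add_le (a.eval m) (b.eval m)
      simp only [Exp.eval]
      nlinarith
    · simp only [Exp.cost]
      nlinarith
  | sub a b iha ihb =>
    obtain ⟨B, hB⟩ := iha
    obtain ⟨D, hD⟩ := ihb
    refine ⟨2 * (B + D), fun L m hL hm => ?_⟩
    obtain ⟨h1, h2⟩ := hB L m hL hm
    obtain ⟨h3, h4⟩ := hD L m hL hm
    have h5 := hsq L hL
    refine ⟨?_, ?_⟩
    · have := bitLength_mono (Nat.sub_le (a.eval m) (b.eval m))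
      simp only [Exp.eval]
      nlinarith
    · simp only [Exp.cost]
      nlinarith
  | mul a b iha ihb =>
    obtain ⟨B, hB⟩ := iha
    obtain ⟨D, hD⟩ := ihb
    refine ⟨B + D + B * D, fun L m hL hm => ?_⟩
    obtain ⟨h1, h2⟩ := hB L m hL hm
    obtain ⟨h3, h4⟩ := hD L m hL hm
    refine ⟨?_, ?_⟩
    · have := bitLength_mul_le (a.eval m) (b.eval m)
      simp only [Exp.eval]
      nlinarith
    · have := Nat.mul_le_mul h1 h3
      simp only [Exp.cost]
      nlinarith

namespace Prog

def LoopFree : Prog → Prop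
  | .skip => True
  | .store _ _ => True
  | .emit _ => True
  | .seq p q => p.LoopFree ∧ q.LoopFree
  | .ite _ p q => p.LoopFree ∧ q.LoopFree
  | .while _ _ => False

/-- No gate issued by the program is a subtraction. -/
def SubtractionFree : Prog → Prop
  | .skip => True
  | .store _ _ => True
  | .emit g => g.op ≠ ArithOp.sub
  | .seq p q => p.SubtractionFree ∧ q.SubtractionFree
  | .ite _ p q => p.SubtractionFree ∧ q.SubtractionFree
  | .while _ p => p.SubtractionFree

/-- The gates issued by a loop-free program and its final memory. -/
def exec : Prog → Memory → Circuit × Memory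
  | .skip, m => ([], m)
  | .store a e, m => ([], Function.update m (a.eval m) (e.eval m))
  | .emit g, m => ([g.map (Exp.eval m)], m)
  | .seq p q, m => ((p.exec m).1 ++ (q.exec (p.exec m).2).1, (q.exec (p.exec m).2).2)
  | .ite e p q, m => if e.eval m ≠ 0 then p.exec m else q.exec m
  | .while _ _, m => ([], m)

lemma SubtractionFree.exec {p : Prog} (h : p.SubtractionFree) (m : Memory) :
    (p.exec m).1.SubtractionFree := by
  induction p generalizing m with
  | skip => simp [Prog.exec, Circuit.SubtractionFree]
  | store a e => simp [Prog.exec, Circuit.SubtractionFree]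
  | emit g =>
    intro g' hg'
    simp only [Prog.exec, List.mem_singleton] at hg'
    subst hg'
    exact h
  | seq p q ihp ihq =>
    intro g hg
    rcases List.mem_append.mp hg with hg | hg
    · exact ihp h.1 m g hg
    · exact ihq h.2 _ g hg
  | ite e p q ihp ihq =>
    simp only [Prog.exec]
    split_ifs
    · exact ihp h.1 m
    · exact ihq h.2 m
  -- Only `while` remains, to which `exec` assigns the default value of no gates.
  | _ => simp [Prog.exec, Circuit.SubtractionFree]

/-- Each instruction enlarges the constant by an amount independent of `L`. In a sequence the second
program starts from the memory bound left by the first, hence the induction for all `A`. -/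
lemma LoopFree.exists_bound {p : Prog} (h : p.LoopFree) (A : ℕ) : ∃ B, ∀ (L : ℕ) (m : Memory),
    1 ≤ L → (∀ a, bitLength (m a) ≤ A * L) →
      (∃ t, Runs p m (p.exec m).1 (p.exec m).2 t ∧ t ≤ B * L ^ 2) ∧
        ∀ a, bitLength ((p.exec m).2 a) ≤ B * L := by
  induction p generalizing A with
  | skip =>
    refine ⟨A + 1, fun L m hL hm => ⟨⟨1, .skip m, ?_⟩, fun a => (hm a).trans ?_⟩⟩
    · have : 0 < L ^ 2 := Nat.pow_pos hL
      nlinarith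
    · exact Nat.mul_le_mul_right _ (Nat.le_succ A)
  | store a e =>
    obtain ⟨B, hB⟩ := a.exists_bound A
    obtain ⟨D, hD⟩ := e.exists_bound A
    refine ⟨2 * (B + D) + A, fun L m hL hm => ?_⟩
    obtain ⟨h1, h2⟩ := hB L m hL hm
    obtain ⟨h3, h4⟩ := hD L m hL hm
    have h5 : L ≤ L ^ 2 := Nat.le_self_pow two_ne_zero L
    refine ⟨⟨_, .store m a e, by nlinarith⟩, fun b => ?_⟩
    simp only [exec, Function.update_apply]
    split_ifs
    · nlinarith
    · have := hm b
      nlinarith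
  | emit g =>
    obtain ⟨B, hB⟩ := g.left.index.exists_bound A
    obtain ⟨D, hD⟩ := g.right.index.exists_bound A
    refine ⟨2 * (B + D) + A + 1, fun L m hL hm => ?_⟩
    obtain ⟨h1, h2⟩ := hB L m hL hm
    obtain ⟨h3, h4⟩ := hD L m hL hm
    have h5 : L ≤ L ^ 2 := Nat.le_self_pow two_ne_zero L
    refine ⟨⟨_, .emit m g, ?_⟩, fun b => ?_⟩
    · simp only [Operand.cost]
      nlinarith
    · have := hm b
      simp only [exec]
      nlinarith
  | seq p q ihp ihq =>
    obtain ⟨B, hB⟩ := ihp h.1 A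
    obtain ⟨D, hD⟩ := ihq h.2 B
    refine ⟨B + D, fun L m hL hm => ?_⟩
    obtain ⟨⟨t, hr, ht⟩, hm'⟩ := hB L m hL hm
    obtain ⟨⟨t', hr', ht'⟩, hm''⟩ := hD L _ hL hm'
    refine ⟨⟨_, .seq hr hr', by nlinarith⟩, fun a => (hm'' a).trans ?_⟩
    exact Nat.mul_le_mul_right _ (Nat.le_add_left _ _)
  | ite e p q ihp ihq =>
    obtain ⟨E, hE⟩ := e.exists_bound A
    obtain ⟨B, hB⟩ := ihp h.1 A
    obtain ⟨D, hD⟩ := ihq h.2 A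
    refine ⟨2 * E + B + D, fun L m hL hm => ?_⟩
    obtain ⟨h1, h2⟩ := hE L m hL hm
    have h5 : L ≤ L ^ 2 := Nat.le_self_pow two_ne_zero L
    simp only [exec]
    split_ifs with he
    · obtain ⟨⟨t, hr, ht⟩, hm'⟩ := hB L m hL hm
      refine ⟨⟨_, .ite_true he hr, by nlinarith⟩, fun a => (hm' a).trans ?_⟩
      exact Nat.mul_le_mul_right _ (by omega)
    · obtain ⟨⟨t, hr, ht⟩, hm'⟩ := hD L m hL hm
      refine ⟨⟨_, .ite_false (not_not.mp he) hr, by nlinarith⟩, fun a => (hm' a).trans ?_⟩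
      exact Nat.mul_le_mul_right _ (by omega)
  | _ => exact h.elim

end Prog

/-- A loop invariant that counts up to `N` gives termination after `N` passes. -/
lemma exists_runs_while {e : Exp} {p : Prog} {N T : ℕ} (Inv : ℕ → Memory → Circuit → Prop)
    (step : ∀ q < N, ∀ m c, Inv q m c → e.eval m ≠ 0 ∧ ∃ c' m' t, Runs p m c' m' t ∧
      e.cost m + bitLength (e.eval m) + t ≤ T ∧ Inv (q + 1) m' (c ++ c'))
    (last : ∀ m c, Inv N m c → e.eval m = 0 ∧ e.cost m + bitLength (e.eval m) ≤ T)
    {m : Memory} {c : Circuit} (h : Inv 0 m c) :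
    ∃ c' m' t, Runs (.while e p) m c' m' t ∧ t ≤ (N + 1) * T ∧ Inv N m' (c ++ c') := by
  suffices H : ∀ d q, q + d = N → ∀ m c, Inv q m c →
      ∃ c' m' t, Runs (.while e p) m c' m' t ∧ t ≤ (d + 1) * T ∧ Inv N m' (c ++ c') from
    H N 0 (Nat.zero_add N) m c h
  intro d
  induction d with
  | zero =>
    rintro q rfl m c h
    obtain ⟨h0, ht⟩ := last m c h
    refine ⟨[], m, _, .while_false h0, by simpa using ht, by simpa using h⟩
  | succ d ih =>
    intro q hq m c h
    obtain ⟨h0, c₁, m₁, t₁, hr, ht, h'⟩ := step q (by omega) m c h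
    obtain ⟨c₂, m₂, t₂, hr', ht', h''⟩ := ih (q + 1) (by omega) m₁ _ h'
    refine ⟨c₁ ++ c₂, m₂, _, .while_true h0 hr hr', by nlinarith, ?_⟩
    rwa [← List.append_assoc]

/-! ### Evaluation of circuits -/

section Run

variable {K : Type} [Field K] {k : ℕ} {y : Fin k → K}

lemma Circuit.run_append {c c' : Circuit} {R R' : List K} (h : Circuit.run y c R = some R') :
    Circuit.run y (c ++ c') R = Circuit.run y c' R' := by
  induction c generalizing R with
  | nil =>
    simp only [Circuit.run, Option.some.injEq] at h
    rw [h, List.nil_append]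
  | cons g c ih =>
    simp only [Circuit.run, List.cons_append, Option.bind_eq_some_iff] at h ⊢
    obtain ⟨v, hv, hr⟩ := h
    rw [hv, Option.bind_some, ih hr]

lemma Circuit.length_of_run {c : Circuit} {R R' : List K} (h : Circuit.run y c R = some R') :
    R'.length = R.length + c.length := by
  induction c generalizing R with
  | nil =>
    simp only [Circuit.run, Option.some.injEq] at h
    simp [h]
  | cons g c ih =>
    simp only [Circuit.run, Option.bind_eq_some_iff] at h
    obtain ⟨v, hv, hr⟩ := h
    rw [ih hr]
    simp
    omega

lemma Gate.value_of_operands {R : List K} {g : Gate ℕ} {a b : K}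
    (ha : g.left.value y R = some a) (hb : g.right.value y R = some b) :
    g.value y R = g.op.apply a b := by
  simp [Gate.value, ha, hb]

end Run

/-! ### The program -/

/-- The position of `(s, m, u)` in lexicographic order, when `m, u < k`. -/
def lexIndex (k s m u : ℕ) : ℕ := (s * k + m) * k + u

section LexIndex

variable {k s m u s' m' u' : ℕ}

lemma lexIndex_lt_of_lt (hs : s' < s) (hm : m' < k) (hu : u' < k) :
    lexIndex k s' m' u' < lexIndex k s m u := by
  have h1 : (s' + 1) * k ≤ s * k := Nat.mul_le_mul_right k hs
  have h2 : s' * k + m' + 1 ≤ s * k + m := by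
    rw [add_mul, one_mul] at h1
    omega
  have h3 := Nat.mul_le_mul_right k h2
  rw [add_mul (s' * k + m'), one_mul] at h3
  unfold lexIndex
  omega

lemma lexIndex_lt_of_mid_lt (hm : m' < m) (hu : u' < k) :
    lexIndex k s m' u' < lexIndex k s m u := by
  have h2 : s * k + m' + 1 ≤ s * k + m := by omega
  have h3 := Nat.mul_le_mul_right k h2
  rw [add_mul (s * k + m'), one_mul] at h3
  unfold lexIndex
  omega

lemma lexIndex_lt_of_last_lt (hu : u' < u) : lexIndex k s m u' < lexIndex k s m u :=
  Nat.add_lt_add_left hu _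

lemma lexIndex_inj (hm : m < k) (hu : u < k) (hm' : m' < k) (hu' : u' < k)
    (h : lexIndex k s' m' u' = lexIndex k s m u) : s' = s ∧ m' = m ∧ u' = u := by
  rcases lt_trichotomy s' s with hs | rfl | hs
  · exact absurd h (lexIndex_lt_of_lt hs hm' hu').ne
  · rcases lt_trichotomy m' m with hs | rfl | hs
    · exact absurd h (lexIndex_lt_of_mid_lt hs hu').ne
    · exact ⟨rfl, rfl, Nat.add_left_cancel h⟩
    · exact absurd h (lexIndex_lt_of_mid_lt hs hu).ne'
  · exact absurd h (lexIndex_lt_of_lt hs hm hu).ne'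

end LexIndex

/-! ### The memory during the run -/

/-- The input memory, extended by three counters. -/
def counterMemory {k : ℕ} (lam : Fin k → ℕ) (s m u : ℕ) : Memory :=
  Function.update (Function.update (Function.update (inputMemory lam) (k + 1) s) (k + 2) m)
    (k + 3) u

section CounterMemory

variable {k : ℕ} (lam : Fin k → ℕ) (s m u : ℕ)

lemma counterMemory_of_le {a : ℕ} (ha : a ≤ k) :
    counterMemory lam s m u a = inputMemory lam a := by
  rw [counterMemory, Function.update_of_ne (by omega), Function.update_of_ne (by omega),
    Function.update_of_ne (by omega)]

lemma counterMemory_zero : counterMemory lam s m u 0 = k :=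
  counterMemory_of_le lam s m u (Nat.zero_le k)

lemma counterMemory_one (hk : 0 < k) : counterMemory lam s m u 1 = lam ⟨0, hk⟩ := by
  rw [counterMemory_of_le lam s m u hk]
  simp [inputMemory, hk]

lemma counterMemory_part (hk : 0 < k) (v : ℕ) :
    counterMemory lam s m u (1 + (k - (v + 1))) = ascPart lam v :=
  counterMemory_of_le lam s m u (by omega)

lemma counterMemory_fst : counterMemory lam s m u (k + 1) = s := by
  simp [counterMemory]

lemma counterMemory_snd : counterMemory lam s m u (k + 2) = m := by
  simp [counterMemory]

lemma counterMemory_trd : counterMemory lam s m u (k + 3) = u := by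
  simp [counterMemory]

lemma update_counterMemory_fst (s' : ℕ) :
    Function.update (counterMemory lam s m u) (k + 1) s' = counterMemory lam s' m u := by
  ext a
  simp only [counterMemory, Function.update_apply]
  split_ifs <;> first | rfl | omega

lemma update_counterMemory_snd (m' : ℕ) :
    Function.update (counterMemory lam s m u) (k + 2) m' = counterMemory lam s m' u := by
  ext a
  simp only [counterMemory, Function.update_apply]
  split_ifs <;> first | rfl | omega

lemma update_counterMemory_trd (u' : ℕ) :
    Function.update (counterMemory lam s m u) (k + 3) u' = counterMemory lam s m u' :=
  Function.update_idem _ _ _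

/-- The counters occupy cells beyond the input, which are zero at the start, so no initialisation is
needed. -/
lemma counterMemory_init : counterMemory lam 0 0 0 = inputMemory lam := by
  ext a
  simp only [counterMemory, Function.update_apply]
  have h : ∀ b, k < b → inputMemory lam b = 0 := by
    intro b hb
    obtain ⟨b, rfl⟩ : ∃ i, b = i + 1 := ⟨b - 1, by omega⟩
    have : ¬ b < k := by omega
    simp [inputMemory, this]
  split_ifs with h1 h2 h3
  · rw [h a (by omega)]
  · rw [h a (by omega)]
  · rw [h a (by omega)]
  · rfl

lemma counterMemory_le {B : ℕ} (hk : k ≤ B) (hl : ∀ i, lam i ≤ B) (hs : s ≤ B) (hm : m ≤ B)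
    (hu : u ≤ B) (a : ℕ) : counterMemory lam s m u a ≤ B := by
  simp only [counterMemory, Function.update_apply]
  split_ifs
  · exact hu
  · exact hm
  · exact hs
  · rcases a with - | a
    · exact hk
    · simp only [inputMemory]
      split_ifs
      · exact hl _
      · exact Nat.zero_le B

end CounterMemory

namespace Exp

def numVars : Exp := .read (.lit 0)

def counterS : Exp := .read (.add numVars (.lit 1))

def counterM : Exp := .read (.add numVars (.lit 2))

def counterU : Exp := .read (.add numVars (.lit 3))

def ascPart (v : Exp) : Exp := .read (.add (.lit 1) (.sub numVars (.add v (.lit 1))))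

def lexIndex (s m u : Exp) : Exp := .add (.mul (.add (.mul s numVars) m) numVars) u

end Exp

/-- The `c`-th of the four gates devoted to `(s, m, u)`. -/
def gateOf (c : ℕ) (s m u : Exp) : Operand Exp :=
  .gate (.add (.mul (.lit 4) (Exp.lexIndex s m u)) (.lit c))

namespace Prog

open Exp (counterS counterM counterU)

/-- Issues three dummy gates and then `g`. -/
def emitPadded (g : Gate Exp) : Prog :=
  let dummy : Prog := .emit ⟨.mul, .scalar (.lit 1), .scalar (.lit 1)⟩
  .seq dummy (.seq dummy (.seq dummy (.emit g)))

/-- Issues the four gates that apply the three-term relation. -/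
def emitExchange : Prog :=
  .seq (.emit ⟨.mul, gateOf 3 (.sub counterS (.lit 1)) counterM counterU,
      gateOf 3 counterS (.sub counterM (.lit 1)) (.add counterU (.lit 1))⟩)
    (.seq (.emit ⟨.mul, gateOf 3 (.sub counterS (.lit 1)) counterM (.add counterU (.lit 1)),
        gateOf 3 counterS (.sub counterM (.lit 1)) counterU⟩)
      (.seq (.emit ⟨.add, gateOf 0 counterS counterM counterU,
          gateOf 1 counterS counterM counterU⟩)
        (.emit ⟨.div, gateOf 2 counterS counterM counterU,
          gateOf 3 (.sub counterS (.lit 1)) (.sub counterM (.lit 1)) (.add counterU (.lit 1))⟩)))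

/-- Issues four gates, the last of which computes `truncMinor lam s m u`, where `s`, `m`, `u` are
the values of the counters. -/
def emitBlock : Prog :=
  .ite counterS
    (.ite (.sub counterS (Exp.ascPart (.add counterU counterM)))
      (emitPadded ⟨.mul, gateOf 3 (.sub counterS (.lit 1)) counterM counterU, .scalar (.lit 1)⟩)
      (.ite (.sub counterS (Exp.ascPart counterU))
        emitExchange
        (emitPadded ⟨.mul, gateOf 3 (.sub counterS (.lit 1)) counterM counterU,
          gateOf 3 (.lit 0) counterM (.lit 0)⟩)))
    (.ite counterU
      (emitPadded ⟨.mul, gateOf 3 (.lit 0) counterM (.sub counterU (.lit 1)),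
        gateOf 3 (.lit 0) counterM (.lit 0)⟩)
      (.ite counterM
        (emitPadded ⟨.mul, gateOf 3 (.lit 0) (.sub counterM (.lit 1)) (.lit 0), .var counterM⟩)
        (emitPadded ⟨.mul, .var (.lit 0), .scalar (.lit 1)⟩)))

/-- Advances the counters to the next triple in lexicographic order. -/
def advance : Prog :=
  .ite (.sub Exp.numVars (.add counterU (.lit 1)))
    (.store (.add Exp.numVars (.lit 3)) (.add counterU (.lit 1)))
    (.seq (.store (.add Exp.numVars (.lit 3)) (.lit 0))
      (.ite (.sub Exp.numVars (.add counterM (.lit 1)))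
        (.store (.add Exp.numVars (.lit 2)) (.add counterM (.lit 1)))
        (.seq (.store (.add Exp.numVars (.lit 2)) (.lit 0))
          (.store (.add Exp.numVars (.lit 1)) (.add counterS (.lit 1))))))

def schurCond : Exp := .sub (.add (.read (.lit 1)) (.lit 1)) counterS

def schurBody : Prog := .seq emitBlock advance

/-- Divides `truncMinor lam (lam 0) (k - 1) 0` by `truncMinor lam 0 (k - 1) 0`. -/
def emitQuotient : Prog :=
  .emit ⟨.div, gateOf 3 (.read (.lit 1)) (.sub Exp.numVars (.lit 1)) (.lit 0),
    gateOf 3 (.lit 0) (.sub Exp.numVars (.lit 1)) (.lit 0)⟩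

def schurProg : Prog := .seq (.while schurCond schurBody) emitQuotient

lemma loopFree_schurBody : schurBody.LoopFree := by
  simp [schurBody, emitBlock, advance, emitPadded, emitExchange, LoopFree]

lemma subtractionFree_schurBody : schurBody.SubtractionFree := by
  simp [schurBody, emitBlock, advance, emitPadded, emitExchange, SubtractionFree]

/-- Whichever counters carry over, the position grows by exactly one, as for a number written in
base k with an unbounded leading digit. -/
lemma exec_advance {k : ℕ} (lam : Fin k → ℕ) {s m u : ℕ} (hm : m < k) (hu : u < k) :
    ∃ s' m' u', m' < k ∧ u' < k ∧ lexIndex k s' m' u' = lexIndex k s m u + 1 ∧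
      advance.exec (counterMemory lam s m u) = ([], counterMemory lam s' m' u') := by
  simp only [advance, exec, Exp.eval, counterS, counterM, counterU, Exp.numVars,
    counterMemory_zero, counterMemory_fst, counterMemory_snd, counterMemory_trd,
    update_counterMemory_fst, update_counterMemory_snd, update_counterMemory_trd]
  split_ifs with h1 h2
  · exact ⟨s, m, u + 1, hm, by omega, rfl, rfl⟩
  · refine ⟨s, m + 1, 0, by omega, by omega, ?_, rfl⟩
    obtain rfl : k = u + 1 := by omega
    simp only [lexIndex]
    ring
  · refine ⟨s + 1, 0, 0, by omega, by omega, ?_, rfl⟩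
    obtain rfl : k = u + 1 := by omega
    obtain rfl : m = u := by omega
    simp only [lexIndex]
    ring

end Prog

/-! ### Correctness -/

section Correctness

variable {k : ℕ} {lam : Fin k → ℕ}

/-- Among the results `R` of the first `4 * q` gates are the minors `truncMinor lam s m u` for the
first `q` triples `(s, m, u)`. -/
def HoldsMinors (lam : Fin k → ℕ) (q : ℕ) (R : List (RatFun k)) : Prop :=
  R.length = 4 * q ∧ ∀ s m u, m < k → u < k → lexIndex k s m u < q →
    R[4 * lexIndex k s m u + 3]? = some (truncMinor lam s m u) ∧ PosAtOne (truncMinor lam s m u)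

namespace HoldsMinors

variable {q s m u : ℕ} {R : List (RatFun k)}

lemma getElem? (h : HoldsMinors lam q R) (hm : m < k) (hu : u < k) (hq : lexIndex k s m u < q)
    (R' : List (RatFun k)) :
    (R ++ R')[4 * lexIndex k s m u + 3]? = some (truncMinor lam s m u) := by
  rw [List.getElem?_append_left (by rw [h.1]; omega)]
  exact (h.2 s m u hm hu hq).1

lemma posAtOne (h : HoldsMinors lam q R) (hm : m < k) (hu : u < k) (hq : lexIndex k s m u < q) :
    PosAtOne (truncMinor lam s m u) :=
  (h.2 s m u hm hu hq).2

lemma succ (h : HoldsMinors lam (lexIndex k s m u) R) (hm : m < k) (hu : u < k) (a b c : RatFun k)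
    (hpos : PosAtOne (truncMinor lam s m u)) :
    HoldsMinors lam (lexIndex k s m u + 1) (R ++ [a, b, c, truncMinor lam s m u]) := by
  refine ⟨by simp [h.1]; omega, fun s' m' u' hm' hu' hq => ?_⟩
  rcases Nat.lt_succ_iff_lt_or_eq.mp hq with hlt | heq
  · exact ⟨h.getElem? hm' hu' hlt _, h.posAtOne hm' hu' hlt⟩
  · obtain ⟨rfl, rfl, rfl⟩ := lexIndex_inj hm hu hm' hu' heq
    refine ⟨?_, hpos⟩
    rw [← h.1, List.getElem?_append_right (Nat.le_add_right _ _), Nat.add_sub_cancel_left]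
    rfl

end HoldsMinors

lemma run_emitPadded {R : List (RatFun k)} {g : Gate Exp} {mem : Memory} {v : RatFun k}
    (h : (g.map (Exp.eval mem)).value (x k) (R ++ [1, 1, 1]) = some v) :
    Circuit.run (x k) ((Prog.emitPadded g).exec mem).1 R = some (R ++ [1, 1, 1, v]) := by
  have hd : ∀ R' : List (RatFun k), (Gate.map (Exp.eval mem)
      ⟨.mul, .scalar (.lit 1), .scalar (.lit 1)⟩).value (x k) R' = some 1 := by
    intro R'
    simp [Gate.map, Gate.value, Operand.map, Operand.value, Exp.eval, ArithOp.apply]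
  have h' : (g.map (Exp.eval mem)).value (x k) (R ++ [1] ++ [1] ++ [1]) = some v := by
    simpa using h
  simp only [Prog.emitPadded, Prog.exec, List.cons_append, List.nil_append, Circuit.run, hd,
    Option.bind_some, h']
  simp

open Prog in
-- Each branch matches one recurrence for the minors; what has to be checked is that its operands
-- come earlier in the lexicographic order and that divisors are nonzero.
lemma run_emitBlock (hl : Antitone lam) (hk : 0 < k) {s m u : ℕ} (hs : s ≤ lam ⟨0, hk⟩)
    (hm : m < k) (hu : u < k) {R : List (RatFun k)}
    (h : HoldsMinors lam (lexIndex k s m u) R) :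
    ∃ R', Circuit.run (x k) (emitBlock.exec (counterMemory lam s m u)).1 R = some R' ∧
      HoldsMinors lam (lexIndex k s m u + 1) R' := by
  suffices H : ∃ a b c, Circuit.run (x k) (emitBlock.exec (counterMemory lam s m u)).1 R =
      some (R ++ [a, b, c, truncMinor lam s m u]) ∧ PosAtOne (truncMinor lam s m u) by
    obtain ⟨a, b, c, hr, hp⟩ := H
    exact ⟨_, hr, h.succ hm hu a b c hp⟩
  have ev : ∀ (c : ℕ) (s' m' u' : Exp), (gateOf c s' m' u').map
      (Exp.eval (counterMemory lam s m u)) = .gate (4 * lexIndex k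
        (s'.eval (counterMemory lam s m u)) (m'.eval (counterMemory lam s m u))
        (u'.eval (counterMemory lam s m u)) + c) := by
    intro c s' m' u'
    simp only [gateOf, Operand.map, Exp.eval, Exp.lexIndex, lexIndex, Exp.numVars,
      counterMemory_zero]
  have hS : Exp.counterS.eval (counterMemory lam s m u) = s := by
    simp only [Exp.counterS, Exp.numVars, Exp.eval, counterMemory_zero, counterMemory_fst]
  have hM : Exp.counterM.eval (counterMemory lam s m u) = m := by
    simp only [Exp.counterM, Exp.numVars, Exp.eval, counterMemory_zero, counterMemory_snd]
  have hU : Exp.counterU.eval (counterMemory lam s m u) = u := by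
    simp only [Exp.counterU, Exp.numVars, Exp.eval, counterMemory_zero, counterMemory_trd]
  have hP : ∀ e : Exp, (Exp.ascPart e).eval (counterMemory lam s m u) =
      ascPart lam (e.eval (counterMemory lam s m u)) := by
    intro e
    simp only [Exp.ascPart, Exp.numVars, Exp.eval, counterMemory_zero, counterMemory_part _ _ _ _ hk]
  have hone : ∀ R' : List (RatFun k), (Operand.scalar 1 : Operand ℕ).value (x k) R' = some 1 := by
    intro R'
    simp [Operand.value]
  have hvar : ∀ (j : ℕ), j < k → ∀ R' : List (RatFun k),
      (Operand.var j : Operand ℕ).value (x k) R' = some (natVar k j) := by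
    intro j hj R'
    simp [Operand.value, natVar, hj]
  have hmul : ∀ (o o' : Operand Exp) (R' : List (RatFun k)) (a b : RatFun k),
      (o.map (Exp.eval (counterMemory lam s m u))).value (x k) R' = some a →
      (o'.map (Exp.eval (counterMemory lam s m u))).value (x k) R' = some b →
      (Gate.map (Exp.eval (counterMemory lam s m u)) ⟨.mul, o, o'⟩).value (x k) R' =
        some (a * b) := fun o o' R' a b ha hb => Gate.value_of_operands ha hb
  simp only [emitBlock, exec, hS, Exp.eval, hP, hM, hU]
  rcases Nat.eq_zero_or_pos s with rfl | hs0
  · rw [if_neg (not_not.mpr rfl)]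
    rcases Nat.eq_zero_or_pos u with rfl | hu0
    · rw [if_neg (not_not.mpr rfl)]
      rcases Nat.eq_zero_or_pos m with rfl | hm0
      · rw [if_neg (not_not.mpr rfl)]
        have e : truncMinor lam 0 0 0 = natVar k 0 * 1 := by
          rw [truncMinor_zero hl hm]
          simp
        refine ⟨1, 1, 1, run_emitPadded ?_, ?_⟩
        · rw [e]
          exact hmul _ _ _ _ _ (hvar 0 hk _) (hone _)
        · rw [e]
          exact (PosAtOne.natVar hk).mul PosAtOne.one
      · rw [if_pos hm0.ne']
        have e : truncMinor lam 0 m 0 = truncMinor lam 0 (m - 1) 0 * natVar k m := by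
          rw [truncMinor_zero hl hm, truncMinor_zero hl (by omega), Nat.sub_add_cancel hm0,
            Finset.prod_range_succ]
          ring
        have hlt : lexIndex k 0 (m - 1) 0 < lexIndex k 0 m 0 :=
          lexIndex_lt_of_mid_lt (by omega) hk
        refine ⟨1, 1, 1, run_emitPadded ?_, ?_⟩
        · rw [e]
          refine hmul _ _ _ _ _ ?_ ?_
          · rw [ev]
            simp only [Exp.eval, hM]
            exact h.getElem? (by omega) hk hlt _
          · simp only [Operand.map, hM]
            exact hvar m hm _
        · rw [e]
          exact (h.posAtOne (by omega) hk hlt).mul (PosAtOne.natVar hm)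
    · rw [if_pos hu0.ne']
      have e : truncMinor lam 0 m u = truncMinor lam 0 m (u - 1) * truncMinor lam 0 m 0 := by
        rw [truncMinor_zero hl hm, truncMinor_zero hl hm, truncMinor_zero hl hm,
          Nat.sub_add_cancel hu0]
        ring
      have hlt : lexIndex k 0 m (u - 1) < lexIndex k 0 m u :=
        lexIndex_lt_of_last_lt (by omega)
      have hlt' : lexIndex k 0 m 0 < lexIndex k 0 m u := lexIndex_lt_of_last_lt hu0
      refine ⟨1, 1, 1, run_emitPadded ?_, ?_⟩
      · rw [e]
        refine hmul _ _ _ _ _ ?_ ?_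
        · rw [ev]
          simp only [Exp.eval, hM, hU]
          exact h.getElem? hm (by omega) hlt _
        · rw [ev]
          simp only [Exp.eval, hM]
          exact h.getElem? hm hk hlt' _
      · rw [e]
        exact (h.posAtOne hm (by omega) hlt).mul (h.posAtOne hm hk hlt')
  · rw [if_pos hs0.ne']
    obtain ⟨s, rfl⟩ : ∃ t, s = t + 1 := ⟨s - 1, by omega⟩
    have hprev : ∀ {m' u' : ℕ}, m' < k → u' < k →
        lexIndex k s m' u' < lexIndex k (s + 1) m u := fun hm' hu' =>
      lexIndex_lt_of_lt (Nat.lt_succ_self s) hm' hu'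
    split_ifs with h1 h2
    · have e : truncMinor lam (s + 1) m u = truncMinor lam s m u * 1 := by
        rw [truncMinor_succ_of_le hl (by omega), mul_one]
      refine ⟨1, 1, 1, run_emitPadded ?_, ?_⟩
      · rw [e]
        refine hmul _ _ _ _ _ ?_ (hone _)
        rw [ev]
        simp only [Exp.eval, hS, hM, hU]
        exact h.getElem? hm hu (hprev hm hu) _
      · rw [e]
        exact (h.posAtOne hm hu (hprev hm hu)).mul PosAtOne.one
    -- The mixed case needs a row that stays and a row that moves, hence at least two rows.
    · have hm0 : m ≠ 0 := by
        rintro rfl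
        exact h1 h2
      obtain ⟨m, rfl⟩ : ∃ n, m = n + 1 := ⟨m - 1, by omega⟩
      -- The parts are constant from index k - 1 on, so a window with both kinds of rows starts
      -- before that; the entry at u + 1 is then in the table.
      have hu1 : u + 1 < k := by
        by_contra hc
        rw [ascPart_of_le hk (by omega)] at h2
        omega
      have hlt : lexIndex k (s + 1) m (u + 1) < lexIndex k (s + 1) (m + 1) u :=
        lexIndex_lt_of_mid_lt (Nat.lt_succ_self m) hu1
      have hlt' : lexIndex k (s + 1) m u < lexIndex k (s + 1) (m + 1) u :=
        lexIndex_lt_of_mid_lt (Nat.lt_succ_self m) hu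
      have hm' : m < k := by omega
      have key := truncMinor_succ_mul hl (s := s) (m := m) (u := u) (by omega) (by omega)
      have hd := h.posAtOne hm' hu1 (hprev hm' hu1)
      set a := truncMinor lam s (m + 1) u * truncMinor lam (s + 1) m (u + 1) with ha
      set b := truncMinor lam s (m + 1) (u + 1) * truncMinor lam (s + 1) m u with hb
      have e : truncMinor lam (s + 1) (m + 1) u = (a + b) / truncMinor lam s m (u + 1) := by
        rw [eq_div_iff hd.ne_zero, key]
      have ha' : PosAtOne a := (h.posAtOne hm hu (hprev hm hu)).mul (h.posAtOne hm' hu1 hlt)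
      have hb' : PosAtOne b := (h.posAtOne hm hu1 (hprev hm hu1)).mul (h.posAtOne hm' hu hlt')
      refine ⟨a, b, a + b, ?_, by rw [e]; exact (ha'.add hb').div hd⟩
      have g1 : (Gate.map (Exp.eval (counterMemory lam (s + 1) (m + 1) u)) ⟨.mul,
          gateOf 3 (.sub .counterS (.lit 1)) .counterM .counterU,
          gateOf 3 .counterS (.sub .counterM (.lit 1)) (.add .counterU (.lit 1))⟩).value
          (x k) R = some a := by
        refine hmul _ _ _ _ _ ?_ ?_
        · rw [ev]
          simp only [Exp.eval, hS, hM, hU, Nat.add_sub_cancel]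
          exact (h.2 _ _ _ hm hu (hprev hm hu)).1
        · rw [ev]
          simp only [Exp.eval, hS, hM, hU, Nat.add_sub_cancel]
          exact (h.2 _ _ _ hm' hu1 hlt).1
      have g2 : (Gate.map (Exp.eval (counterMemory lam (s + 1) (m + 1) u)) ⟨.mul,
          gateOf 3 (.sub .counterS (.lit 1)) .counterM (.add .counterU (.lit 1)),
          gateOf 3 .counterS (.sub .counterM (.lit 1)) .counterU⟩).value
          (x k) (R ++ [a]) = some b := by
        refine hmul _ _ _ _ _ ?_ ?_
        · rw [ev]
          simp only [Exp.eval, hS, hM, hU, Nat.add_sub_cancel]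
          exact h.getElem? hm hu1 (hprev hm hu1) _
        · rw [ev]
          simp only [Exp.eval, hS, hM, hU, Nat.add_sub_cancel]
          exact h.getElem? hm' hu hlt' _
      -- `R` has four results per earlier triple, so these gate numbers point into the current
      -- block.
      have hcur : ∀ c (R' : List (RatFun k)), (R ++ R')[4 * lexIndex k (s + 1) (m + 1) u + c]? =
          R'[c]? := by
        intro c R'
        rw [← h.1, List.getElem?_append_right (Nat.le_add_right _ _), Nat.add_sub_cancel_left]
      have g3 : (Gate.map (Exp.eval (counterMemory lam (s + 1) (m + 1) u)) ⟨.add,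
          gateOf 0 .counterS .counterM .counterU, gateOf 1 .counterS .counterM .counterU⟩).value
          (x k) (R ++ [a] ++ [b]) = some (a + b) := by
        refine Gate.value_of_operands ?_ ?_
        · simp only [Gate.map, ev, hS, hM, hU, Operand.value, List.append_assoc, hcur]
          rfl
        · simp only [Gate.map, ev, hS, hM, hU, Operand.value, List.append_assoc, hcur]
          rfl
      have g4 : (Gate.map (Exp.eval (counterMemory lam (s + 1) (m + 1) u)) ⟨.div,
          gateOf 2 .counterS .counterM .counterU, gateOf 3 (.sub .counterS (.lit 1))
            (.sub .counterM (.lit 1)) (.add .counterU (.lit 1))⟩).value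
          (x k) (R ++ [a] ++ [b] ++ [a + b]) = some (truncMinor lam (s + 1) (m + 1) u) := by
        rw [Gate.value_of_operands (a := a + b) (b := truncMinor lam s m (u + 1))]
        · simp only [Gate.map, ArithOp.apply, if_neg hd.ne_zero, e]
        · simp only [Gate.map, ev, hS, hM, hU, Operand.value, List.append_assoc, hcur]
          rfl
        · simp only [Gate.map, ev, Exp.eval, hS, hM, hU, Nat.add_sub_cancel, List.append_assoc]
          exact h.getElem? hm' hu1 (hprev hm' hu1) _
      simp only [emitExchange, exec, List.cons_append, List.nil_append, Circuit.run, g1, g2, g3,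
        g4, Option.bind_some]
      simp
    · have e := truncMinor_succ_of_lt hl (s := s) (m := m) (u := u) hm (by omega)
      have hlt : lexIndex k 0 m 0 < lexIndex k (s + 1) m u :=
        lexIndex_lt_of_lt (Nat.succ_pos s) hm hk
      refine ⟨1, 1, 1, run_emitPadded ?_, ?_⟩
      · rw [e]
        refine hmul _ _ _ _ _ ?_ ?_
        · rw [ev]
          simp only [Exp.eval, hS, hM, hU]
          exact h.getElem? hm hu (hprev hm hu) _
        · rw [ev]
          simp only [Exp.eval, hM]
          exact h.getElem? hm hk hlt _
      · rw [e]
        exact (h.posAtOne hm hu (hprev hm hu)).mul (h.posAtOne hm hk hlt)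

end Correctness

/-! ### The loop invariant and the final bounds -/

/-- After `q` passes through the loop of `Prog.schurProg`, the circuit `c` has been issued. -/
def LoopInvariant {k : ℕ} (lam : Fin k → ℕ) (q : ℕ) (mem : Memory) (c : Circuit) : Prop :=
  ∃ s m u, m < k ∧ u < k ∧ lexIndex k s m u = q ∧ mem = counterMemory lam s m u ∧
    c.SubtractionFree ∧ ∃ R, Circuit.run (x k) c [] = some R ∧ HoldsMinors lam q R

lemma Circuit.SubtractionFree.append {c c' : Circuit} (h : c.SubtractionFree)
    (h' : c'.SubtractionFree) : Circuit.SubtractionFree (c ++ c') := by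
  intro g hg
  rcases List.mem_append.mp hg with hg | hg
  · exact h g hg
  · exact h' g hg

section

variable {k : ℕ} {lam : Fin k → ℕ}

lemma loopInvariant_zero (hk : 0 < k) : LoopInvariant lam 0 (inputMemory lam) [] := by
  refine ⟨0, 0, 0, hk, hk, by simp [lexIndex], (counterMemory_init lam).symm, by simp
    [Circuit.SubtractionFree], [], rfl, rfl, ?_⟩
  intro s m u _ _ h
  exact absurd h (Nat.not_lt_zero _)

lemma exec_schurBody (mem : Memory) {mem' : Memory}
    (h : Prog.advance.exec mem = ([], mem')) (he : (Prog.emitBlock.exec mem).2 = mem) :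
    Prog.schurBody.exec mem = ((Prog.emitBlock.exec mem).1, mem') := by
  simp only [Prog.schurBody, Prog.exec, he, h, List.append_nil]

lemma emitBlock_exec_snd (mem : Memory) : (Prog.emitBlock.exec mem).2 = mem := by
  simp only [Prog.emitBlock, Prog.emitPadded, Prog.emitExchange, Prog.exec]
  split_ifs <;> rfl

lemma LoopInvariant.step (hl : Antitone lam) (hk : 0 < k) {q : ℕ}
    (hq : q < lexIndex k (lam ⟨0, hk⟩ + 1) 0 0) {mem : Memory} {c : Circuit}
    (h : LoopInvariant lam q mem c) :
    Prog.schurCond.eval mem ≠ 0 ∧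
      LoopInvariant lam (q + 1) (Prog.schurBody.exec mem).2 (c ++ (Prog.schurBody.exec mem).1) := by
  obtain ⟨s, m, u, hm, hu, rfl, rfl, hc, R, hR, hH⟩ := h
  have hs : s ≤ lam ⟨0, hk⟩ := by
    by_contra hs
    have h1 : lexIndex k (lam ⟨0, hk⟩ + 1) 0 0 ≤ lexIndex k s m u := by
      unfold lexIndex
      gcongr <;> omega
    omega
  refine ⟨?_, ?_⟩
  · simp only [Prog.schurCond, Exp.counterS, Exp.numVars, Exp.eval, counterMemory_zero,
      counterMemory_fst, counterMemory_one _ _ _ _ hk]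
    omega
  · obtain ⟨s', m', u', hm', hu', hi, he⟩ := Prog.exec_advance lam (s := s) hm hu
    obtain ⟨R', hR', hH'⟩ := run_emitBlock hl hk hs hm hu hH
    have hb := exec_schurBody _ he (emitBlock_exec_snd _)
    refine ⟨s', m', u', hm', hu', hi, by rw [hb], ?_, R', ?_, hH'⟩
    · exact hc.append (Prog.subtractionFree_schurBody.exec _)
    · rw [hb, Circuit.run_append hR, hR']

lemma LoopInvariant.counter_le (hk : 0 < k) {q : ℕ}
    (hq : q ≤ lexIndex k (lam ⟨0, hk⟩ + 1) 0 0) {s m u : ℕ} (h : lexIndex k s m u = q) :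
    s ≤ lam ⟨0, hk⟩ + 1 := by
  by_contra hs
  have : lexIndex k (lam ⟨0, hk⟩ + 1) 0 0 < lexIndex k s m u :=
    lexIndex_lt_of_lt (by omega) hk hk
  omega

/-- All cells stay at most n throughout the run, so the lengths do not grow from pass to pass; the
factor 3 is slack. -/
lemma LoopInvariant.bitLength_le (hl : Antitone lam) (hk : 0 < k) {q : ℕ}
    (hq : q ≤ lexIndex k (lam ⟨0, hk⟩ + 1) 0 0) {mem : Memory} {c : Circuit}
    (h : LoopInvariant lam q mem c) (a : ℕ) :
    bitLength (mem a) ≤ 3 * bitLength (k + lam ⟨0, hk⟩) := by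
  obtain ⟨s, m, u, hm, hu, hi, rfl, -⟩ := h
  have hs := counter_le hk hq hi
  have hle : counterMemory lam s m u a ≤ k + lam ⟨0, hk⟩ :=
    counterMemory_le lam s m u (Nat.le_add_right _ _)
      (fun i => (hl (Fin.le_def.mpr (Nat.zero_le _))).trans (Nat.le_add_left _ _))
      (by omega) (by omega) (by omega) a
  have := bitLength_mono hle
  omega

lemma LoopInvariant.schurCond_eq_zero (hk : 0 < k) {mem : Memory} {c : Circuit}
    (h : LoopInvariant lam (lexIndex k (lam ⟨0, hk⟩ + 1) 0 0) mem c) :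
    Prog.schurCond.eval mem = 0 := by
  obtain ⟨s, m, u, hm, hu, hi, rfl, -⟩ := h
  simp only [Prog.schurCond, Exp.counterS, Exp.numVars, Exp.eval, counterMemory_zero,
    counterMemory_fst, counterMemory_one _ _ _ _ hk]
  by_contra hs
  have : lexIndex k s m u < lexIndex k (lam ⟨0, hk⟩ + 1) 0 0 :=
    lexIndex_lt_of_lt (by omega) hm hu
  omega

lemma LoopInvariant.computes (hl : Antitone lam) (hk : 0 < k) {mem : Memory} {c : Circuit}
    (h : LoopInvariant lam (lexIndex k (lam ⟨0, hk⟩ + 1) 0 0) mem c) :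
    Circuit.Computes (c ++ (Prog.emitQuotient.exec mem).1) (x k) (schur lam) ∧
      c.length = 4 * lexIndex k (lam ⟨0, hk⟩ + 1) 0 0 := by
  obtain ⟨s, m, u, hm, hu, hi, rfl, -, R, hR, hH⟩ := h
  have hlen := Circuit.length_of_run hR
  rw [hH.1, List.length_nil, zero_add] at hlen
  have hk1 : k - 1 < k := by omega
  have hlt : ∀ t ≤ lam ⟨0, hk⟩, lexIndex k t (k - 1) 0 < lexIndex k (lam ⟨0, hk⟩ + 1) 0 0 :=
    fun t ht => lexIndex_lt_of_lt (by omega) hk1 hk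
  refine ⟨⟨R ++ [schur lam], ?_, by simp⟩, hlen.symm⟩
  have hv : (Gate.map (Exp.eval (counterMemory lam s m u)) ⟨.div,
      gateOf 3 (.read (.lit 1)) (.sub .numVars (.lit 1)) (.lit 0),
      gateOf 3 (.lit 0) (.sub .numVars (.lit 1)) (.lit 0)⟩).value (x k) R = some (schur lam) := by
    have h1 := hH.2 (lam ⟨0, hk⟩) (k - 1) 0 hk1 hk (hlt _ le_rfl)
    have h0 := hH.2 0 (k - 1) 0 hk1 hk (hlt 0 (Nat.zero_le _))
    have hk' := counterMemory_zero lam s m u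
    have hl' := counterMemory_one lam s m u hk
    rw [Gate.value_of_operands (a := truncMinor lam (lam ⟨0, hk⟩) (k - 1) 0)
      (b := truncMinor lam 0 (k - 1) 0)]
    · simp only [Gate.map, ArithOp.apply, if_neg h0.2.ne_zero, truncMinor_div hl hk]
    · simp only [Gate.map, gateOf, Operand.map, Exp.lexIndex, Exp.eval, Exp.numVars, hk', hl']
      exact h1.1
    · simp only [Gate.map, gateOf, Operand.map, Exp.lexIndex, Exp.eval, Exp.numVars, hk']
      exact h0.1
  rw [Circuit.run_append hR]
  simp only [Prog.emitQuotient, Prog.exec, Circuit.run, hv, Option.bind_some]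

end

lemma lexIndex_le_pow_three {k l : ℕ} (hk : 0 < k) : lexIndex k (l + 1) 0 0 ≤ (k + l) ^ 3 := by
  have h1 : l + 1 ≤ k + l := by omega
  have h2 : k ≤ k + l := by omega
  calc lexIndex k (l + 1) 0 0 = (l + 1) * k * k := by simp [lexIndex]
    _ ≤ (k + l) * (k + l) * (k + l) := by gcongr
    _ = (k + l) ^ 3 := by ring

end SchurCircuit

open SchurCircuit in
theorem theorem2p1 :
    ∃ (P : Prog) (C : ℕ), ∀ (k : ℕ) (hk : 0 < k) (lam : Fin k → ℕ), Antitone lam →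
      ∃ (c : Circuit) (m : Memory) (t : ℕ),
        Runs P (inputMemory lam) c m t ∧
        c.SubtractionFree ∧
        c.Computes (x k) (schur lam) ∧
        c.length ≤ C * (k + lam ⟨0, hk⟩) ^ 3 ∧
        t ≤ C * (k + lam ⟨0, hk⟩) ^ 3 * bitLength (k + lam ⟨0, hk⟩) ^ 2 := by
  obtain ⟨B, hB⟩ := Prog.loopFree_schurBody.exists_bound 3
  obtain ⟨E, hE⟩ := Prog.schurCond.exists_bound 3
  obtain ⟨D, hD⟩ := Prog.LoopFree.exists_bound (p := Prog.emitQuotient) trivial 3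
  -- One pass costs `2 * E + B` (test and body) in units of the squared length, and N + 1 ≤ 2n³
  -- evaluations of the test occur; `D` pays for the last gate. The 5 covers the 4N + 1 gates.
  refine ⟨Prog.schurProg, 2 * (2 * E + B) + D + 5, fun k hk lam hl => ?_⟩
  set n := k + lam ⟨0, hk⟩ with hn
  have hL : 1 ≤ bitLength n := one_le_bitLength n
  have hL2 : bitLength n ≤ bitLength n ^ 2 := Nat.le_self_pow two_ne_zero _
  have hN : lexIndex k (lam ⟨0, hk⟩ + 1) 0 0 ≤ n ^ 3 := lexIndex_le_pow_three hk
  have hn3 : 1 ≤ n ^ 3 := Nat.pow_pos (by omega)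
  obtain ⟨c, mem, t, hr, ht, hI⟩ := exists_runs_while (e := Prog.schurCond)
    (p := Prog.schurBody) (N := lexIndex k (lam ⟨0, hk⟩ + 1) 0 0)
    (T := (2 * E + B) * bitLength n ^ 2) (LoopInvariant lam)
    (fun q hq m c h => by
      obtain ⟨h1, h2⟩ := h.step hl hk hq
      have hb := h.bitLength_le hl hk hq.le
      obtain ⟨⟨t, hr, ht⟩, -⟩ := hB _ m hL hb
      obtain ⟨h3, h4⟩ := hE _ m hL hb
      exact ⟨h1, _, _, t, hr, by nlinarith, h2⟩)
    (fun m c h => by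
      obtain ⟨h3, h4⟩ := hE _ m hL (h.bitLength_le hl hk le_rfl)
      exact ⟨h.schurCond_eq_zero hk, by nlinarith⟩)
    (loopInvariant_zero hk)
  rw [List.nil_append] at hI
  obtain ⟨⟨t', hr', ht'⟩, -⟩ := hD _ mem hL (hI.bitLength_le hl hk le_rfl)
  obtain ⟨hcomp, hlen⟩ := hI.computes hl hk
  obtain ⟨-, -, -, -, -, -, -, hsf, -⟩ := hI
  refine ⟨_, _, _, .seq hr hr', hsf.append (Prog.SubtractionFree.exec
    (p := Prog.emitQuotient) (by simp [Prog.emitQuotient, Prog.SubtractionFree]) mem), hcomp,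
    ?_, ?_⟩
  · rw [List.length_append, hlen]
    have : (Prog.emitQuotient.exec mem).1.length = 1 := rfl
    rw [this]
    nlinarith
  · set L2 := bitLength n ^ 2
    calc t + t' ≤ (lexIndex k (lam ⟨0, hk⟩ + 1) 0 0 + 1) * ((2 * E + B) * L2) + D * L2 :=
          Nat.add_le_add ht ht'
      _ ≤ (n ^ 3 + n ^ 3) * ((2 * E + B) * L2) + D * n ^ 3 * L2 := by
          gcongr
          exact Nat.le_mul_of_pos_right _ hn3
      _ = (2 * (2 * E + B) + D) * n ^ 3 * L2 := by ring
      _ ≤ (2 * (2 * E + B) + D + 5) * n ^ 3 * L2 := by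
          exact Nat.mul_le_mul_right _ (Nat.mul_le_mul_right _ (Nat.le_add_right _ _))
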